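/- Theorem 2.1. Let $L$ be a real vector space equipped with a topology $\tau$ and its Borel $\sigma$-algebra; no compatibility between $\tau$ and the vector space operations is assumed (in particular, $(\lambda,x)\mapsto\lambda x$ need not be continuous). Let $S$ be an $L$-valued Borel random variable on a probability space which is ordinary stable, that is: the distribution of $S$ is not a point mass, and there exist independent identically distributed $L$-valued Borel random variables $\xi_1,\xi_2,\dots$ (on some probability space) and non-random numbers $A(n)>0$ with $A(n)\to\infty$ such that the normed sums $$S(n)=\frac{\xi_1+\dots+\xi_n}{A(n)}$$ are random variables and converge to $S$ in distribution, i.e. $\mathbf{E} f(S(n))\to \mathbf{E} f(S)$ as $n\to\infty$ for every bounded continuous $f:L\to\mathbb{R}$. Let $L_0\subseteq L$ be a linear subspace of the form $L_0=\bigcap_j\ker b_j$ for some countable or finite family of continuous linear functionals $b_j:L\to\mathbb{R}$. Then $$\mathbf{P}(S\in L_0)=0\quad\text{or}\quad \mathbf{P}(S\in L_0)=1 .$$ -/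

import Mathlib

open MeasureTheory ProbabilityTheory Filter Topology

universe u v w

/-- `S` is *ordinary stable*: its distribution is non-degenerate (not a point mass), and `S` is a
limit in distribution (weak convergence of the laws, tested against bounded continuous functions)
of the normed sums `(ξ₁ + ⋯ + ξₙ) / A(n)` of independent identically distributed `L`-valued
random variables `ξᵢ`, which may live on another probability space, where the `A(n)` are positive
numbers tending to infinity.

No compatibility between the topology and the vector space structure of `L` is assumed;
`TendstoInDistribution` contains the requirement that the normed sums are (a.e.) Borel measurable,
so that they have a distribution. -/
def IsOrdinaryStable {L : Type u} [AddCommGroup L] [Module ℝ L] [TopologicalSpace L]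
    [MeasurableSpace L] [BorelSpace L] {Ω : Type v} [MeasurableSpace Ω]
    (P : Measure Ω) [IsProbabilityMeasure P] (S : Ω → L) : Prop :=
  (∀ x : L, P.map S ≠ Measure.dirac x) ∧
  ∃ (Ω' : Type w) (_ : MeasurableSpace Ω') (P' : Measure Ω') (_ : IsProbabilityMeasure P')
    (ξ : ℕ → Ω' → L) (A : ℕ → ℝ),
    (∀ i, Measurable (ξ i)) ∧
    iIndepFun ξ P' ∧
    (∀ i, IdentDistrib (ξ i) (ξ 0) P' P') ∧
    (∀ n, 1 ≤ n → 0 < A n) ∧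
    Tendsto A atTop atTop ∧
    TendstoInDistribution (fun (n : ℕ) (ω : Ω') => (A n)⁻¹ • ∑ i ∈ Finset.range n, ξ i ω)
      atTop S (fun _ => P') P

/-- The subspace `L₀` is *countably generated*: it is the intersection of the kernels of a
countable (possibly finite) family of continuous linear functionals. -/
def IsCountablyGeneratedSubspace {L : Type*} [AddCommGroup L] [Module ℝ L] [TopologicalSpace L]
    (L₀ : Submodule ℝ L) : Prop :=
  ∃ B : Set (L →L[ℝ] ℝ), B.Countable ∧ L₀ = ⨅ b ∈ B, LinearMap.ker (b : L →ₗ[ℝ] ℝ)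

/-! By countability it suffices to treat one functional `b`: if the law μ of `b ∘ S` has an atom at
0, then that atom has mass 1. Since `b` is linear and continuous, μ is a weak limit of normed sums
of i.i.d. real variables. Comparing sums of `n` and `2 * n` terms along a subsequence on which the
ratio of norming constants converges gives μ = δ₀ or μ ∗ μ = law of `d • Y` with Y ~ μ. In the
second case with `d ≠ 0`, the maximal atom mass M of μ is also that of μ ∗ μ. Equality in the
averaging bound forces μ to be purely atomic with finitely many atoms, all of mass M. The sum 2m of
the largest atom m with itself arises in only one way, so it has mass M² in μ ∗ μ, where every atom
has mass M. Hence M = 1. -/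

/-- The mass given by a self-convolution to a point, as an integral over the first summand. -/
lemma conv_self_singleton (μ : Measure ℝ) [IsProbabilityMeasure μ] (x : ℝ) :
    (μ.conv μ) {x} = ∫⁻ y, μ {x - y} ∂μ := by
  rw [Measure.conv, Measure.map_apply (by fun_prop) (measurableSet_singleton x),
    Measure.prod_apply (measurableSet_preimage (by fun_prop) (measurableSet_singleton x))]
  refine lintegral_congr fun y => congrArg μ ?_
  ext z
  simp [eq_sub_iff_add_eq, add_comm]

/-- Only finitely many atoms of a finite measure have mass bounded below. -/
lemma finite_setOf_le_measure_singleton (μ : Measure ℝ) [IsFiniteMeasure μ] {ε : ENNReal}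
    (hε : 0 < ε) : {x : ℝ | ε ≤ μ {x}}.Finite :=
  Measure.finite_const_le_meas_of_disjoint_iUnion μ hε (As := fun x : ℝ => {x})
    (fun x => measurableSet_singleton x) (fun x y hxy => by simpa using hxy) (measure_ne_top _ _)

/-- A finite measure with an atom has an atom of maximal mass. -/
lemma exists_max_measure_singleton (μ : Measure ℝ) [IsFiniteMeasure μ] {a : ℝ} (ha : μ {a} ≠ 0) :
    ∃ x₀, ∀ y, μ {y} ≤ μ {x₀} := by
  obtain ⟨x₀, hx₀, h⟩ := (finite_setOf_le_measure_singleton μ (pos_iff_ne_zero.2 ha)).exists_maximalFor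
    (fun x => μ {x}) _ ⟨a, le_refl (μ {a})⟩
  refine ⟨x₀, fun y => ?_⟩
  rcases le_total (μ {y}) (μ {x₀}) with hy | hy
  · exact hy
  · exact h (le_trans hx₀ hy) hy

/-- If the self-convolution of a probability measure on the line is a rescaling of the measure,
then an atom at the origin carries the whole mass. -/
lemma measure_singleton_zero_eq_one_of_conv_self {μ : Measure ℝ} [IsProbabilityMeasure μ] {d : ℝ}
    (hconv : μ.conv μ = μ.map (d * ·)) (h0 : μ {0} ≠ 0) : μ {0} = 1 := by
  have ae_mem {f : ℝ → ENNReal} {M : ENNReal} (hf : ∀ y, f y ≤ M) (hM : M ≠ ⊤)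
      (hint : ∫⁻ y, f y ∂μ = M) (hfm : Measurable f) : ∀ᵐ y ∂μ, f y = M := by
    refine ae_eq_of_ae_le_of_lintegral_le (ae_of_all _ hf) ?_ aemeasurable_const ?_
    · rwa [hint]
    · simp [hint]
  have meas (x : ℝ) : Measurable fun y => μ {x - y} := by
    have h : MeasurableSet {p : ℝ × ℝ | p.2 = x - p.1} :=
      measurableSet_eq_fun (by fun_prop) (by fun_prop)
    exact measurable_measure_prodMk_left h
  have atom_of_ae {p : ℝ → Prop} {y : ℝ} (h : ∀ᵐ z ∂μ, p z) (hy : μ {y} ≠ 0) : p y := by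
    by_contra hp
    exact hy (measure_mono_null (by simpa using hp) (ae_iff.1 h))
  -- For `d = 0`, μ ∗ μ = δ₀, so `μ {-y} = 1` for almost every `y`, in particular at the atom 0.
  rcases eq_or_ne d 0 with rfl | hd
  · have h : ∫⁻ y, μ {0 - y} ∂μ = 1 := by
      rw [← conv_self_singleton, hconv]
      simp [Measure.map_const]
    simpa using atom_of_ae (ae_mem (fun y => prob_le_one) ENNReal.one_ne_top h (meas 0)) h0
  have hscale (x : ℝ) : ∫⁻ y, μ {d * x - y} ∂μ = μ {x} := by
    rw [← conv_self_singleton, hconv, Measure.map_apply (by fun_prop) (measurableSet_singleton _)]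
    congr 1
    ext z
    simp [hd]
  obtain ⟨x₀, hx₀⟩ := exists_max_measure_singleton μ h0
  set M := μ {x₀} with hM
  have hMpos : 0 < M := (pos_iff_ne_zero.2 h0).trans_le (hx₀ 0)
  have hMtop : M ≠ ⊤ := measure_ne_top _ _
  have hae := ae_mem (fun y => hx₀ _) hMtop (hscale x₀) (meas _)
  -- The reflection `y ↦ d * x₀ - y` sends atoms to atoms of mass `M`; applying it twice returns to
  -- `y`.
  have hatom {y : ℝ} (hy : μ {y} ≠ 0) : μ {y} = M := by
    have h := atom_of_ae hae hy
    have h' := atom_of_ae hae (y := d * x₀ - y) (by rw [h]; exact hMpos.ne')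
    simpa using h'
  obtain ⟨m, hm, hmax⟩ := (finite_setOf_le_measure_singleton μ hMpos).exists_maximalFor id _
    ⟨x₀, le_refl M⟩
  have hle {y : ℝ} (hy : μ {y} ≠ 0) : y ≤ m := by
    rcases le_total y m with h | h
    · exact h
    · exact hmax (show M ≤ μ {y} from (hatom hy).ge) h
  have hmM : μ {m} = M := hatom (hMpos.trans_le hm).ne'
  have htop : ∫⁻ y, μ {2 * m - y} ∂μ = M * M := by
    have : ∀ᵐ y ∂μ, μ {2 * m - y} = ({m} : Set ℝ).indicator (fun _ => M) y := by
      -- Almost every `y` is itself an atom, since its reflection is one; so `y ≤ m`, and `2 * m - y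
      -- ≤ m` if that is an atom too.
      filter_upwards [hae] with y hy
      have hyat : μ {y} ≠ 0 := by
        have h := atom_of_ae hae (y := d * x₀ - y) (by rw [hy]; exact hMpos.ne')
        rw [sub_sub_cancel] at h
        exact h ▸ hMpos.ne'
      by_cases hym : y = m
      · subst hym
        simp [two_mul, hmM]
      · rw [Set.indicator_of_notMem (by simpa using hym)]
        by_contra h
        exact hym (le_antisymm (hle hyat) (by linarith [hle h]))
    rw [lintegral_congr_ae this, lintegral_indicator_const (measurableSet_singleton m), hmM]
  have hsq : M * M = M := by
    have h := hscale (2 * m / d)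
    rw [mul_div_cancel₀ _ hd, htop] at h
    rw [h]
    exact hatom (by rw [← h]; simp [hMpos.ne'])
  rw [hatom h0, (ENNReal.mul_eq_left hMpos.ne' hMtop).1 hsq]

/-- Characteristic functions of a sequence converging in distribution converge along converging
rescalings of the argument. -/
lemma tendsto_charFun_of_tendstoInDistribution {Ω Ω' : Type*} [MeasurableSpace Ω]
    [MeasurableSpace Ω'] {P : Measure Ω} [IsProbabilityMeasure P] {P' : Measure Ω'}
    [IsProbabilityMeasure P'] {X : ℕ → Ω' → ℝ} {Y : Ω → ℝ}
    (h : TendstoInDistribution X atTop Y (fun _ => P') P) {a : ℕ → ℝ} {c : ℝ}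
    (ha : Tendsto a atTop (𝓝 c)) (t : ℝ) :
    Tendsto (fun n => charFun (P'.map (X n)) (a n * t)) atTop
      (𝓝 (charFun (P.map Y) (c * t))) := by
  -- Slutsky's theorem, with the numbers `a n` as constant random variables.
  have h' := h.continuous_comp_prodMk_of_tendstoInMeasure_const
    (g := fun p : ℝ × ℝ => p.2 * p.1) (by fun_prop) (Y := fun n _ => a n) (c := c)
    (tendstoInMeasure_of_tendsto_ae (fun _ => by fun_prop) (ae_of_all _ fun _ => ha))
    (fun _ => by fun_prop)
  have h'' := ProbabilityMeasure.tendsto_iff_tendsto_charFun.1 h'.tendsto t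
  simpa [charFun_map_mul_comp, h.forall_aemeasurable, h.aemeasurable_limit] using h''

/-- Convergence in distribution passes to subsequences. -/
lemma tendstoInDistribution_comp {Ω Ω' E : Type*} [MeasurableSpace Ω]
    [MeasurableSpace Ω'] {P : Measure Ω} [IsProbabilityMeasure P] {P' : Measure Ω'}
    [IsProbabilityMeasure P'] [TopologicalSpace E] [MeasurableSpace E] [OpensMeasurableSpace E]
    {X : ℕ → Ω' → E} {Y : Ω → E}
    (h : TendstoInDistribution X atTop Y (fun _ => P') P) {σ : ℕ → ℕ}
    (hσ : Tendsto σ atTop atTop) :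
    TendstoInDistribution (fun n => X (σ n)) atTop Y (fun _ => P') P where
  forall_aemeasurable _ := h.forall_aemeasurable _
  aemeasurable_limit := h.aemeasurable_limit
  tendsto := h.tendsto.comp hσ

/-- The law of a weak limit of normed sums of i.i.d. real random variables is either the point mass
at the origin or has a self-convolution which is a rescaling of itself. -/
lemma conv_self_of_tendstoInDistribution {Ω Ω' : Type*} [MeasurableSpace Ω]
    [MeasurableSpace Ω'] {P : Measure Ω} [IsProbabilityMeasure P] {P' : Measure Ω'}
    [IsProbabilityMeasure P'] {η : ℕ → Ω' → ℝ} {A : ℕ → ℝ} {Y : Ω → ℝ}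
    (hη : ∀ i, Measurable (η i)) (hindep : iIndepFun η P')
    (hident : ∀ i, IdentDistrib (η i) (η 0) P' P') (hA : ∀ n, 1 ≤ n → 0 < A n)
    (hlim : TendstoInDistribution
      (fun (n : ℕ) (ω : Ω') => (A n)⁻¹ * ∑ i ∈ Finset.range n, η i ω) atTop Y (fun _ => P') P) :
    P.map Y = Measure.dirac 0 ∨ ∃ d : ℝ, (P.map Y).conv (P.map Y) = (P.map Y).map (d * ·) := by
  have : IsProbabilityMeasure (P.map Y) := Measure.isProbabilityMeasure_map hlim.aemeasurable_limit
  set μ := P.map Y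
  set X := fun (n : ℕ) (ω : Ω') => (A n)⁻¹ * ∑ i ∈ Finset.range n, η i ω with hX
  have hchar (n : ℕ) (t : ℝ) :
      charFun (P'.map (X n)) t = charFun (P'.map (η 0)) ((A n)⁻¹ * t) ^ n := by
    rw [hX, charFun_map_mul_comp (by fun_prop),
      (hindep.restrict _).charFun_map_fun_finsetSum_eq_prod (fun i _ => (hη i).aemeasurable)]
    simp [fun i => (hident i).map_eq]
  have hdouble {n : ℕ} (hn : 1 ≤ n) (t : ℝ) : charFun (P'.map (X (2 * n))) t =
      charFun (P'.map (X n)) ((A n / A (2 * n)) * t) ^ 2 := by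
    have := (hA n hn).ne'
    rw [hchar, hchar, ← pow_mul, mul_comm 2 n]
    congr 2
    field_simp
  have hdouble' {n : ℕ} (hn : 1 ≤ n) (t : ℝ) : charFun (P'.map (X n)) t ^ 2 =
      charFun (P'.map (X (2 * n))) ((A (2 * n) / A n) * t) := by
    have := (hA n hn).ne'
    have := (hA (2 * n) (by omega)).ne'
    rw [hdouble hn, ← mul_assoc]
    field_simp
  have htwo : Tendsto (fun n : ℕ => 2 * n) atTop atTop :=
    tendsto_id.const_mul_atTop' (by norm_num)
  have hsub (σ : ℕ → ℕ) (hσ : Tendsto σ atTop atTop) (t : ℝ) :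
      Tendsto (fun n => charFun (P'.map (X (σ n))) t) atTop (𝓝 (charFun μ t)) := by
    simpa using tendsto_charFun_of_tendstoInDistribution (tendstoInDistribution_comp hlim hσ)
      (tendsto_const_nhds (x := (1 : ℝ))) t
  have hpos (n : ℕ) (hn : 1 ≤ n) : 0 ≤ A n / A (2 * n) :=
    (div_pos (hA n hn) (hA _ (by omega))).le
  have hpos' (n : ℕ) (hn : 1 ≤ n) : 0 ≤ A (2 * n) / A n :=
    (div_pos (hA _ (by omega)) (hA n hn)).le
  -- `A` need not be monotone, but the ratio or its inverse lies in [0, 1] infinitely often, which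
  -- gives compactness.
  by_cases hfreq : ∃ᶠ n in atTop, A n ≤ A (2 * n)
  · obtain ⟨c, -, σ, hσ, hc⟩ := isCompact_Icc.tendsto_subseq' (x := fun n => A n / A (2 * n))
      (s := Set.Icc (0 : ℝ) 1) ((hfreq.and_eventually (eventually_ge_atTop 1)).mono fun n hn =>
        ⟨hpos n hn.2, div_le_one_of_le₀ hn.1 (hA _ (by omega)).le⟩)
    have hσ := hσ.tendsto_atTop
    have key (t : ℝ) : charFun μ t = charFun μ (c * t) ^ 2 := by
      refine tendsto_nhds_unique (hsub _ (htwo.comp hσ) t) ?_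
      refine ((tendsto_charFun_of_tendstoInDistribution (tendstoInDistribution_comp hlim hσ) hc
        t).pow 2).congr' ?_
      filter_upwards [hσ.eventually_ge_atTop 1] with n hn
      exact (hdouble hn t).symm
    -- If `c = 0`, `key` makes the characteristic function identically 1.
    rcases eq_or_ne c 0 with rfl | hc0
    · left
      refine Measure.ext_of_charFun (funext fun t => ?_)
      rw [key t]
      simp [charFun_dirac]
    · right
      refine ⟨c⁻¹, Measure.ext_of_charFun (funext fun t => ?_)⟩
      rw [charFun_conv, charFun_map_mul, key (c⁻¹ * t), mul_inv_cancel_left₀ hc0, sq]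
  · right
    have hev : ∀ᶠ n in atTop, A (2 * n) / A n ∈ Set.Icc (0 : ℝ) 1 := by
      filter_upwards [not_frequently.1 hfreq, eventually_ge_atTop 1] with n hn hn1
      exact ⟨hpos' n hn1, div_le_one_of_le₀ (not_le.1 hn).le (hA n hn1).le⟩
    obtain ⟨d, -, σ, hσ, hd⟩ := isCompact_Icc.tendsto_subseq' hev.frequently
    have hσ := hσ.tendsto_atTop
    -- Here the limit ratio is already the scale factor, so `d = 0` needs no separate case.
    refine ⟨d, Measure.ext_of_charFun (funext fun t => ?_)⟩
    rw [charFun_conv, charFun_map_mul, ← sq]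
    refine tendsto_nhds_unique ((hsub σ hσ t).pow 2) ?_
    refine (tendsto_charFun_of_tendstoInDistribution
      (tendstoInDistribution_comp hlim (htwo.comp hσ)) hd t).congr' ?_
    filter_upwards [hσ.eventually_ge_atTop 1] with n hn
    exact (hdouble' hn t).symm

theorem theorem2p1 {L : Type u} [AddCommGroup L] [Module ℝ L] [TopologicalSpace L]
    [MeasurableSpace L] [BorelSpace L] {Ω : Type v} [MeasurableSpace Ω]
    (P : Measure Ω) [IsProbabilityMeasure P] (S : Ω → L) (hS : Measurable S)
    (hstable : IsOrdinaryStable.{u, v, w} P S)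
    (L₀ : Submodule ℝ L) (hL₀ : IsCountablyGeneratedSubspace L₀) :
    P {ω | S ω ∈ L₀} = 0 ∨ P {ω | S ω ∈ L₀} = 1 := by
  obtain ⟨-, Ω', _, P', _, ξ, A, hξ, hindep, hident, hA, -, hlim⟩ := hstable
  obtain ⟨B, hB, rfl⟩ := hL₀
  refine or_iff_not_imp_left.2 fun hne => ?_
  have hset : {ω | S ω ∈ ⨅ b ∈ B, LinearMap.ker (b : L →ₗ[ℝ] ℝ)} = {ω | ∀ b ∈ B, b (S ω) = 0} := by
    ext ω
    simp
  rw [hset] at hne ⊢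
  suffices ∀ᵐ ω ∂P, ∀ b ∈ B, b (S ω) = 0 from
    (measure_congr (eventuallyEq_univ.2 this)).trans measure_univ
  refine (ae_ball_iff hB).2 fun b hb => ?_
  have hbm : Measurable b := b.continuous.measurable
  have hpre : (P.map (b ∘ S)) {0} = P {ω | b (S ω) = 0} :=
    Measure.map_apply (hbm.comp hS) (measurableSet_singleton 0)
  have hatom : (P.map (b ∘ S)) {0} ≠ 0 := fun h =>
    hne (measure_mono_null (fun ω hω => hω b hb) (hpre.symm.trans h))
  have hprob : IsProbabilityMeasure (P.map (b ∘ S)) :=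
    Measure.isProbabilityMeasure_map (hbm.comp hS).aemeasurable
  have hone : (P.map (b ∘ S)) {0} = 1 := by
    have hlim' : TendstoInDistribution
        (fun (n : ℕ) (ω : Ω') => (A n)⁻¹ * ∑ i ∈ Finset.range n, (b ∘ ξ i) ω) atTop (b ∘ S)
        (fun _ => P') P := by
      simpa [Function.comp_def, map_sum] using hlim.continuous_comp b.continuous
    rcases conv_self_of_tendstoInDistribution (η := fun i => b ∘ ξ i)
      (fun i => hbm.comp (hξ i)) (hindep.comp (fun _ => b) fun _ => hbm)
      (fun i => (hident i).comp hbm) hA hlim' with h | ⟨d, h⟩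
    · simp [h]
    · exact measure_singleton_zero_eq_one_of_conv_self h hatom
  rw [hpre] at hone
  exact (prob_compl_eq_zero_iff (hbm.comp hS (measurableSet_singleton 0))).2 hone
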